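/- Let $A>0$ and let $\phi,\psi:\mathbb R\to\mathbb R$ be bounded measurable functions vanishing outside $[-A,A]$, with $\int\psi=0$, such that the functions $\psi_{-1k}(x)=\phi(x-k)$ and $\psi_{jk}(x)=2^{j/2}\psi(2^jx-k)$, $j\ge 0$, $k\in\mathbb Z$, form an orthonormal basis of $L^2(\mathbb R)$. Let $\beta>1/2$ and $\beta_{jk}(f)=\int f\psi_{jk}$. Let $\mathcal F_\beta$ be the class of probability densities $f\ge 0$ in $L^2$ supported on $[0,1]$ (extended by $0$ to $\mathbb R$) with $\|f\|_\beta^2:=\sum_{j\ge -1}(2^j)^{2\beta}\sum_k\beta_{jk}(f)^2<\infty$. Given $\varepsilon\in[0,1]$, $f\in\mathcal F_\beta$ and an arbitrary probability distribution $G$ on $[0,1]$, let $X_1,\dots,X_n$ be i.i.d. with distribution $(1-\varepsilon)P_f+\varepsilon G$, where $P_f$ has density $f$. Let $W_{ijk}$ be i.i.d. standard Laplace variables (density $e^{-|x|}/2$), independent of the $X_i$. For $\alpha\in(0,1)$ and an integer $J\ge 1$ put $\sigma_J=C_A2^{J/2}/\alpha$ with $C_A=(8\lceil A\rceil+4)\|\psi\|_\infty\sqrt2(\sqrt2-1)^{-1}$,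 and $$\hat\beta_{jk}=\frac1n\sum_{i=1}^n\{\psi_{jk}(X_i)+\sigma_JW_{ijk}\},\qquad \hat f_{\mathrm{Lap}}=\sum_{j=-1}^{J}\sum_{k\in\mathcal N_j}\hat\beta_{jk}\psi_{jk},$$ where each $\mathcal N_j$ is any set of integers that contains all $k$ with $\beta_{jk}(f)\ne0$ and only such $k$ for which $[(k-A)2^{-j},(k+A)2^{-j}]$ meets $[0,1]$ (for $j=-1$: $[k-A,k+A]$ meets $[0,1]$); for instance, all the latter $k$. Then for all $r,c_1,c_2>0$ there is a constant $C>0$, depending only on $A,\phi,\psi,\beta,r,c_1,c_2$, such that for all $n$, all $\alpha\in(0,1)$ with $n\alpha^2\ge2$, all $\varepsilon\in[0,1]$, all integers $J\ge1$ with $$c_1T\le 2^J\le c_2T,\qquad T=\Big\{\frac{\log(n\alpha^2)}{n\alpha^2}\Big\}^{-\frac1{2\beta+1}}\wedge\varepsilon^{-\frac2{2\beta+1}}$$ (where $0^{-2/(2\beta+1)}=\infty$), all $f\in\mathcal F_\beta$ with $\|f\|_\beta\le r$, all such $G$ and all such $\mathcal N_j$, $$\mathbb E\,\|\hat f_{\mathrm{Lap}}-f\|_\infty\le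 C\left[\Big\{\frac{\log(n\alpha^2)}{n\alpha^2}\Big\}^{\frac{2\beta-1}{4\beta+2}}\vee\varepsilon^{\frac{2\beta-1}{2\beta+1}}\right].$$ Here $\|\cdot\|_\infty$ is the essential supremum over $[0,1]$; if moreover $f(x)=\sum_{j,k}\beta_{jk}(f)\psi_{jk}(x)$ (unconditionally convergent) for every $x\in[0,1]$, the bound also holds with the supremum over all $x\in[0,1]$. -/

import Mathlib

open MeasureTheory ProbabilityTheory Set
open scoped ENNReal

noncomputable section

namespace PrivateDensity

/-- Number of unit translates per unit length at a level. Levels are indexed by `l = j + 1 : ℕ`,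
so that `l = 0` is the father level `j = -1` (unit scale) and `l = j + 1` is resolution `j`. -/
def scale : ℕ → ℝ
  | 0 => 1
  | j + 1 => 2 ^ j

/-- The wavelet `ψ_{jk}` at level `l = j + 1`: the translate `φ(x - k)` of the father wavelet for
`l = 0` (that is `j = -1`), and `2^{j/2} ψ(2^j x - k)` for `l = j + 1`. -/
def wavelet (φ ψ : ℝ → ℝ) : ℕ → ℤ → ℝ → ℝ
  | 0, k, x => φ (x - k)
  | j + 1, k, x => (2 : ℝ) ^ ((j : ℝ) / 2) * ψ (2 ^ j * x - k)

/-- `φ` and `ψ` are a father and a mother wavelet on `[-A, A]`: bounded functions that vanish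
outside `[-A, A]`, with `∫ ψ = 0`, such that the functions `φ(· - k)` and `2^{j/2} ψ(2^j · - k)`
form an orthonormal (Hilbert) basis of `L²(ℝ)`. -/
structure IsWaveletPair (A : ℝ) (φ ψ : ℝ → ℝ) : Prop where
  measurable_father : Measurable φ
  measurable_mother : Measurable ψ
  father_eq_zero : ∀ x, x ∉ Icc (-A) A → φ x = 0
  mother_eq_zero : ∀ x, x ∉ Icc (-A) A → ψ x = 0
  integral_mother : ∫ x, ψ x = 0
  father_bounded : BddAbove (range fun x => |φ x|)
  mother_bounded : BddAbove (range fun x => |ψ x|)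
  basis : ∃ b : HilbertBasis (ℕ × ℤ) ℝ (Lp ℝ 2 (volume : Measure ℝ)),
    ∀ p : ℕ × ℤ, (b p : ℝ → ℝ) =ᵐ[volume] wavelet φ ψ p.1 p.2

/-- The wavelet coefficient `β_{jk} = ∫ f ψ_{jk}` of `f`, at level `l = j + 1`. -/
def coeff (φ ψ f : ℝ → ℝ) (l : ℕ) (k : ℤ) : ℝ :=
  ∫ x, f x * wavelet φ ψ l k x

/-- The summand `(2^j)^{2β} β_{jk}²` of the squared Sobolev norm, at level `l = j + 1`. -/
def sobolevTerm (φ ψ : ℝ → ℝ) (β : ℝ) (f : ℝ → ℝ) (p : ℕ × ℤ) : ℝ :=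
  ((2 : ℝ) ^ ((p.1 : ℝ) - 1)) ^ (2 * β) * coeff φ ψ f p.1 p.2 ^ 2

/-- The Sobolev class `F_β`: probability densities on `[0, 1]` (extended by zero to `ℝ`) in `L²`
with `∑_{j ≥ -1} (2^j)^{2β} ∑_k β_{jk}² < ∞`. -/
def SobolevClass (φ ψ : ℝ → ℝ) (β : ℝ) : Set (ℝ → ℝ) :=
  {f | (∀ x, 0 ≤ f x) ∧ (∀ x, x ∉ Icc (0 : ℝ) 1 → f x = 0) ∧ MemLp f 2 volume ∧
    ∫ x, f x = 1 ∧ Summable (sobolevTerm φ ψ β f)}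

/-- The squared Sobolev norm `∑_{j ≥ -1} (2^j)^{2β} ∑_k β_{jk}²` of an `f` in `F_β`. -/
def sobolevNormSq (φ ψ : ℝ → ℝ) (β : ℝ) (f : ℝ → ℝ) : ℝ :=
  ∑' p, sobolevTerm φ ψ β f p

/-- The contaminated distribution `(1 - ε) P_f + ε G`. -/
def contaminated (ε : ℝ) (f : ℝ → ℝ) (G : Measure ℝ) : Measure ℝ :=
  ENNReal.ofReal (1 - ε) • volume.withDensity (fun x => ENNReal.ofReal (f x)) +
    ENNReal.ofReal ε • G

/-- The standard Laplace distribution, with density `exp (-|x|) / 2`. -/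
def stdLaplace : Measure ℝ :=
  volume.withDensity fun x => ENNReal.ofReal (Real.exp (-|x|) / 2)

/-- The noise level `σ_J = C 2^{J/2} / α` with
`C = (8⌈A⌉ + 4) ‖ψ‖_∞ √2 (√2 - 1)⁻¹`. -/
def noiseLevel (A : ℝ) (ψ : ℝ → ℝ) (α : ℝ) (J : ℕ) : ℝ :=
  ((8 * (⌈A⌉ : ℝ) + 4) * (⨆ x, |ψ x|) * √2 * (√2 - 1)⁻¹) * (2 : ℝ) ^ ((J : ℝ) / 2) / α

/-- The privatised empirical wavelet coefficient
`(1/n) ∑ᵢ (ψ_{jk}(Xᵢ) + σ_J W_{ijk})`, at level `l = j + 1`, from the data `X` and noise `W`. -/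
def privCoeff (A : ℝ) (φ ψ : ℝ → ℝ) (α : ℝ) (J : ℕ) {n : ℕ} (X : Fin n → ℝ)
    (W : Fin n → ℕ → ℤ → ℝ) (l : ℕ) (k : ℤ) : ℝ :=
  (1 / (n : ℝ)) * ∑ i, (wavelet φ ψ l k (X i) + noiseLevel A ψ α J * W i l k)

/-- The estimator `∑_{j=-1}^{J} ∑_{k ∈ N_j} β̂_{jk} ψ_{jk}`; the levels `l = j + 1` run over
`0, …, J + 1`. -/
def fLap (A : ℝ) (φ ψ : ℝ → ℝ) (α : ℝ) (J : ℕ) (N : ℕ → Finset ℤ) {n : ℕ} (X : Fin n → ℝ)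
    (W : Fin n → ℕ → ℤ → ℝ) (x : ℝ) : ℝ :=
  ∑ l ∈ Finset.range (J + 2), ∑ k ∈ N l, privCoeff A φ ψ α J X W l k * wavelet φ ψ l k x

/-- `N` gives, for every level, a finite set of translations that contains all `k` with
`β_{jk} ≠ 0` and only such `k` for which the interval `[(k - A)/2^j, (k + A)/2^j]`, outside which
`ψ_{jk}` vanishes, meets `[0, 1]` (with `1` in place of `2^j` for the father wavelet). -/
def IsIndexFamily (A : ℝ) (φ ψ f : ℝ → ℝ) (N : ℕ → Finset ℤ) : Prop :=
  ∀ l k, (coeff φ ψ f l k ≠ 0 → k ∈ N l) ∧ (k ∈ N l → -A ≤ (k : ℝ) ∧ (k : ℝ) ≤ scale l + A)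

/-- The order of `2^J`: `{log(nα²)/(nα²)}^{-1/(2β+1)} ∧ ε^{-2/(2β+1)}`, where
`0^{-2/(2β+1)} = ∞`. -/
def resolutionRate (β : ℝ) (n : ℕ) (α ε : ℝ) : ℝ :=
  if ε = 0 then (Real.log (n * α ^ 2) / (n * α ^ 2)) ^ (-(1 / (2 * β + 1)))
  else min ((Real.log (n * α ^ 2) / (n * α ^ 2)) ^ (-(1 / (2 * β + 1))))
    (ε ^ (-(2 / (2 * β + 1))))

/-- The rate `{log(nα²)/(nα²)}^{(2β-1)/(4β+2)} ∨ ε^{(2β-1)/(2β+1)}`. -/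
def riskRate (β : ℝ) (n : ℕ) (α ε : ℝ) : ℝ :=
  max ((Real.log (n * α ^ 2) / (n * α ^ 2)) ^ ((2 * β - 1) / (4 * β + 2)))
    (ε ^ ((2 * β - 1) / (2 * β + 1)))

end PrivateDensity

end

/-!
The loss `f̂_Lap - f` splits at every point where the wavelet series of `f` converges to `f`, that
is almost everywhere (`ae_hasSum_series`), into three parts (`abs_fLap_sub_le`). As the wavelets
have compact support, `∑ₖ |ψ_{jk}(x)| ≤ (2A + 1) M 2^{j/2}` with `M` a bound for the wavelets, so
each part is governed by the largest coefficient error at each level.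

* Truncation: a Sobolev norm at most `r` gives `|β_{jk}| ≤ r 2^{-jβ}`, and the levels above `J`
  contribute a geometric tail of order `2^{-J(β - 1/2)}` (`abs_sub_truncation_le`).
* Contamination: it shifts the mean of `β̂_{jk}` by at most `2 ε M 2^{j/2}`, which sums to order
  `ε 2^J`.
* Stochastic error: divided by `M 2^{J/2} / α`, a centred coefficient is a sum of `n` independent
  pairs consisting of a centred variable of values in an interval of length two (Hoeffding's lemma)
  and a Laplace variable with factor at most one, so its exponential moment at `t ≤ 1/2` is at most
  `exp (4 n t²)`. Since there are `O(2^J)` coefficients, the expected maximum of these sums is of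
  order `J / t + n t` (`exists_dominating`). The choice `t ∼ √(J / n)` is admissible because `J` is
  at most a multiple of `log (n α²) ≤ n`, and makes this part of the loss of order
  `2^J √(J / (n α²))`.

The restrictions on `2^J` turn the three orders into the rate (`total_order_le`). The bound of the
loss is uniform in `x`, so it serves for the essential supremum and for the supremum alike.
-/

namespace PrivateDensity

/-! ### Exponential moments and a maximal inequality -/

lemma measurable_laplaceDensity :
    Measurable fun x : ℝ => ENNReal.ofReal (Real.exp (-|x|) / 2) := by
  fun_prop

lemma lintegral_exp_mul_stdLaplace_le {t : ℝ} (ht : |t| ≤ 1 / 2) :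
    ∫⁻ x, ENNReal.ofReal (Real.exp (t * x)) ∂stdLaplace ≤
      ENNReal.ofReal (Real.exp (2 * t ^ 2)) := by
  obtain ⟨h1, h2⟩ := abs_le.1 ht
  have hpos : 0 < 1 + t := by linarith
  have hneg : t - 1 < 0 := by linarith
  -- the integrand is `exp ((1 + t) x) / 2` on the left and `exp ((t - 1) x) / 2` on the right
  have hl : ∫⁻ x in Iic (0 : ℝ), ENNReal.ofReal (Real.exp (-|x|) / 2) *
      ENNReal.ofReal (Real.exp (t * x)) = ENNReal.ofReal (1 / (1 + t) / 2) := by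
    have : ∫⁻ x in Iic (0 : ℝ), ENNReal.ofReal (Real.exp (-|x|) / 2) *
        ENNReal.ofReal (Real.exp (t * x)) =
        ∫⁻ x in Iic (0 : ℝ), ENNReal.ofReal (Real.exp ((1 + t) * x) / 2) := by
      refine setLIntegral_congr_fun measurableSet_Iic fun x hx => ?_
      rw [← ENNReal.ofReal_mul (by positivity), abs_of_nonpos hx, div_mul_eq_mul_div,
        ← Real.exp_add]
      ring_nf
    rw [this, ← ofReal_integral_eq_lintegral_ofReal
      ((integrableOn_exp_mul_Iic hpos 0).div_const 2) (ae_of_all _ fun x => by positivity),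
      integral_div, integral_exp_mul_Iic hpos]
    simp
  have hr : ∫⁻ x in Ioi (0 : ℝ), ENNReal.ofReal (Real.exp (-|x|) / 2) *
      ENNReal.ofReal (Real.exp (t * x)) = ENNReal.ofReal (1 / (1 - t) / 2) := by
    have : ∫⁻ x in Ioi (0 : ℝ), ENNReal.ofReal (Real.exp (-|x|) / 2) *
        ENNReal.ofReal (Real.exp (t * x)) =
        ∫⁻ x in Ioi (0 : ℝ), ENNReal.ofReal (Real.exp ((t - 1) * x) / 2) := by
      refine setLIntegral_congr_fun measurableSet_Ioi fun x hx => ?_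
      rw [← ENNReal.ofReal_mul (by positivity), abs_of_pos hx, div_mul_eq_mul_div,
        ← Real.exp_add]
      ring_nf
    rw [this, ← ofReal_integral_eq_lintegral_ofReal
      ((integrableOn_exp_mul_Ioi hneg 0).div_const 2) (ae_of_all _ fun x => by positivity),
      integral_div, integral_exp_mul_Ioi hneg]
    have : -1 / (t - 1) = 1 / (1 - t) := by rw [neg_div, ← div_neg, neg_sub]
    simp [this]
  rw [stdLaplace, lintegral_withDensity_eq_lintegral_mul _ measurable_laplaceDensity
    (by fun_prop)]
  simp only [Pi.mul_apply]
  rw [← lintegral_add_compl _ (measurableSet_Iic (a := (0 : ℝ))), compl_Iic, hl, hr,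
    ← ENNReal.ofReal_add (by positivity)
      (div_nonneg (one_div_nonneg.2 (by linarith)) (by norm_num))]
  refine ENNReal.ofReal_le_ofReal ?_
  have hsq : t ^ 2 ≤ 1 / 4 := by nlinarith
  have hs : 1 / (1 + t) / 2 + 1 / (1 - t) / 2 = 1 / (1 - t ^ 2) := by
    have : 1 - t ≠ 0 := by linarith
    have : 1 - t ^ 2 ≠ 0 := by nlinarith
    field_simp
    ring
  -- `1 / (1 - u) ≤ 1 + 2 u ≤ exp (2 u)` for `u = t ^ 2 ≤ 1 / 2`
  rw [hs, div_le_iff₀ (by linarith)]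
  nlinarith [Real.add_one_le_exp (2 * t ^ 2), sq_nonneg t]

lemma lintegral_exp_mul_le_of_abs_le {Ω : Type*} [MeasurableSpace Ω] {P : Measure Ω}
    [IsProbabilityMeasure P] {Y : Ω → ℝ} (hY : AEMeasurable Y P) (hb : ∀ ω, |Y ω| ≤ 1) (t : ℝ) :
    ∫⁻ ω, ENNReal.ofReal (Real.exp (t * (Y ω - ∫ ω', Y ω' ∂P))) ∂P
      ≤ ENNReal.ofReal (Real.exp (2 * t ^ 2)) := by
  have h := hasSubgaussianMGF_of_mem_Icc (μ := P) (a := -1) (b := 1) hY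
    (ae_of_all _ fun ω => abs_le.1 (hb ω))
  rw [← ofReal_integral_eq_lintegral_ofReal (h.integrable_exp_mul t)
    (ae_of_all _ fun _ => (Real.exp_pos _).le)]
  refine ENNReal.ofReal_le_ofReal ((h.mgf_le t).trans (Real.exp_le_exp.2 ?_))
  have : ((((‖(1 : ℝ) - -1‖₊ / 2) ^ 2 : NNReal)) : ℝ) = 1 := by
    simp only [NNReal.coe_pow, NNReal.coe_div, coe_nnnorm, NNReal.coe_ofNat]; norm_num
  rw [this]
  nlinarith [sq_nonneg t]

lemma lintegral_exp_mul_sum_le {Ω ι : Type*} [MeasurableSpace Ω] [Fintype ι] {P : Measure Ω}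
    {Z : ι → Ω → ℝ} (hi : iIndepFun Z P) (hm : ∀ i, AEMeasurable (Z i) P) {t c : ℝ}
    (hZ : ∀ i, ∫⁻ ω, ENNReal.ofReal (Real.exp (t * Z i ω)) ∂P ≤ ENNReal.ofReal (Real.exp c)) :
    ∫⁻ ω, ENNReal.ofReal (Real.exp (t * ∑ i, Z i ω)) ∂P
      ≤ ENNReal.ofReal (Real.exp (Fintype.card ι * c)) := by
  have hint : ∀ i, Integrable (fun ω => Real.exp (t * Z i ω)) P := fun i =>
    ⟨((hm i).const_mul t).exp.aestronglyMeasurable, by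
      rw [hasFiniteIntegral_iff_ofReal (ae_of_all _ fun _ => (Real.exp_pos _).le)]
      exact (hZ i).trans_lt ENNReal.ofReal_lt_top⟩
  have := hi.isProbabilityMeasure
  have hmgf : mgf (∑ i, Z i) P t = ∏ i, mgf (Z i) P t := hi.mgf_sum₀ hm Finset.univ
  have hpos : 0 < mgf (∑ i, Z i) P t := hmgf ▸ Finset.prod_pos fun i _ => mgf_pos (hint i)
  have hintS : Integrable (fun ω => Real.exp (t * (∑ i, Z i) ω)) P := by
    by_contra h
    exact hpos.ne' (mgf_undef h)
  have hle : ∀ i, mgf (Z i) P t ≤ Real.exp c := fun i => by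
    have := hZ i
    rwa [← ofReal_integral_eq_lintegral_ofReal (hint i) (ae_of_all _ fun _ => (Real.exp_pos _).le),
      ENNReal.ofReal_le_ofReal_iff (Real.exp_pos _).le] at this
  simp only [← Finset.sum_apply]
  rw [← ofReal_integral_eq_lintegral_ofReal hintS (ae_of_all _ fun _ => (Real.exp_pos _).le)]
  refine ENNReal.ofReal_le_ofReal ?_
  change mgf (∑ i, Z i) P t ≤ _
  rw [hmgf]
  calc ∏ i, mgf (Z i) P t ≤ ∏ _i : ι, Real.exp c :=
        Finset.prod_le_prod (fun i _ => mgf_nonneg) fun i _ => hle i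
    _ = _ := by simp [← Real.exp_nat_mul]

/-- Maximal inequality. Finitely many variables whose two-sided exponential moments at `t` are at
most `exp v` are dominated by a single variable of mean at most `(a + 1) / t`, where `a` is any
nonnegative number not below `v` plus the logarithm of twice their number. The domination rests on
`t |S| ≤ a + exp (t |S| - a)`, which makes the bounding variable a finite sum of exponentials and
avoids the measurability of a supremum. -/
lemma exists_dominating {Ω ι : Type*} [MeasurableSpace Ω] {P : Measure Ω} [IsProbabilityMeasure P]
    (s : Finset ι) {S : ι → Ω → ℝ} (hS : ∀ p, AEMeasurable (S p) P) {t v a : ℝ} (ht : 0 < t)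
    (ha : 0 ≤ a)
    (h₁ : ∀ p ∈ s, ∫⁻ ω, ENNReal.ofReal (Real.exp (t * S p ω)) ∂P ≤ ENNReal.ofReal (Real.exp v))
    (h₂ : ∀ p ∈ s, ∫⁻ ω, ENNReal.ofReal (Real.exp (-t * S p ω)) ∂P ≤ ENNReal.ofReal (Real.exp v))
    (hcard : 2 * (s.card : ℝ) * Real.exp v ≤ Real.exp a) :
    ∃ R : Ω → ℝ, (∀ ω, 0 ≤ R ω) ∧ (∀ p ∈ s, ∀ ω, |S p ω| ≤ R ω) ∧
      ∫⁻ ω, ENNReal.ofReal (R ω) ∂P ≤ ENNReal.ofReal ((a + 1) / t) := by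
  set E : Ω → ℝ := fun ω => ∑ p ∈ s, (Real.exp (t * S p ω) + Real.exp (-t * S p ω)) with hE
  have hE0 : ∀ ω, 0 ≤ E ω := fun ω => Finset.sum_nonneg fun p _ => by positivity
  have hEint : ∫⁻ ω, ENNReal.ofReal (E ω) ∂P ≤ ENNReal.ofReal (Real.exp a) := by
    calc ∫⁻ ω, ENNReal.ofReal (E ω) ∂P
        = ∑ p ∈ s, ∫⁻ ω, (ENNReal.ofReal (Real.exp (t * S p ω)) +
            ENNReal.ofReal (Real.exp (-t * S p ω))) ∂P := by
          rw [← lintegral_finsetSum']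
          · refine lintegral_congr fun ω => ?_
            rw [hE, ENNReal.ofReal_sum_of_nonneg fun p _ => by positivity]
            exact Finset.sum_congr rfl fun p _ => ENNReal.ofReal_add (by positivity) (by positivity)
          · exact fun p _ => (((hS p).const_mul t).exp.ennreal_ofReal).add
              (((hS p).const_mul (-t)).exp.ennreal_ofReal)
      _ ≤ ∑ _p ∈ s, ENNReal.ofReal (2 * Real.exp v) := by
          refine Finset.sum_le_sum fun p hp => ?_
          rw [lintegral_add_left' (((hS p).const_mul t).exp.ennreal_ofReal), two_mul,
            ENNReal.ofReal_add (by positivity) (by positivity)]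
          exact add_le_add (h₁ p hp) (h₂ p hp)
      _ ≤ ENNReal.ofReal (Real.exp a) := by
          rw [Finset.sum_const, nsmul_eq_mul, ← ENNReal.ofReal_natCast,
            ← ENNReal.ofReal_mul (by positivity)]
          exact ENNReal.ofReal_le_ofReal (by linarith)
  refine ⟨fun ω => t⁻¹ * (a + Real.exp (-a) * E ω), fun ω => ?_, fun p hp ω => ?_, ?_⟩
  · have := hE0 ω
    positivity
  · have hexp : Real.exp (t * |S p ω|) ≤ E ω := by
      refine le_trans ?_ (Finset.single_le_sum
        (f := fun p => Real.exp (t * S p ω) + Real.exp (-t * S p ω))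
        (fun p _ => by positivity) hp)
      rcases abs_cases (S p ω) with ⟨h, _⟩ | ⟨h, _⟩ <;> rw [h]
      · linarith [Real.exp_pos (-t * S p ω)]
      · rw [mul_neg, ← neg_mul]
        linarith [Real.exp_pos (t * S p ω)]
    have h3 : t * |S p ω| - a + 1 ≤ Real.exp (-a) * E ω := by
      refine (Real.add_one_le_exp _).trans ?_
      rw [sub_eq_add_neg, add_comm, Real.exp_add]
      gcongr
    change |S p ω| ≤ t⁻¹ * (a + Real.exp (-a) * E ω)
    rw [← div_eq_inv_mul, le_div_iff₀ ht]
    linarith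
  · have hsplit : ∀ ω, ENNReal.ofReal (t⁻¹ * (a + Real.exp (-a) * E ω)) =
        ENNReal.ofReal t⁻¹ * (ENNReal.ofReal a +
          ENNReal.ofReal (Real.exp (-a)) * ENNReal.ofReal (E ω)) := fun ω => by
      rw [ENNReal.ofReal_mul (by positivity), ENNReal.ofReal_add ha
        (mul_nonneg (Real.exp_pos _).le (hE0 ω)), ENNReal.ofReal_mul (Real.exp_pos _).le]
    simp_rw [hsplit]
    rw [lintegral_const_mul' _ _ ENNReal.ofReal_ne_top, lintegral_add_left measurable_const,
      lintegral_const_mul' _ _ ENNReal.ofReal_ne_top]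
    simp only [lintegral_const, measure_univ, mul_one]
    calc _ ≤ ENNReal.ofReal t⁻¹ * (ENNReal.ofReal a +
          ENNReal.ofReal (Real.exp (-a)) * ENNReal.ofReal (Real.exp a)) := by gcongr
      _ = _ := by
        rw [← ENNReal.ofReal_mul (Real.exp_pos _).le, ← Real.exp_add, neg_add_cancel,
          Real.exp_zero, ← ENNReal.ofReal_add ha zero_le_one,
          ← ENNReal.ofReal_mul (by positivity), div_eq_inv_mul]

/-! ### Size and overlap of the wavelets -/

lemma scale_pos (l : ℕ) : 0 < scale l := by
  cases l <;> simp [scale]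

lemma scale_mono : Monotone scale := by
  refine monotone_nat_of_le_succ fun l => ?_
  cases l with
  | zero => simp [scale]
  | succ j => exact pow_le_pow_right₀ (by norm_num) j.le_succ

lemma sqrt_scale_succ (j : ℕ) : √(scale (j + 1)) = (2 : ℝ) ^ ((j : ℝ) / 2) := by
  rw [Real.sqrt_eq_rpow, scale, ← Real.rpow_natCast, ← Real.rpow_mul (by norm_num)]
  ring_nf

lemma measurable_wavelet {φ ψ : ℝ → ℝ} (hφ : Measurable φ) (hψ : Measurable ψ) (l : ℕ) (k : ℤ) :
    Measurable (wavelet φ ψ l k) := by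
  cases l with
  | zero => exact hφ.comp (measurable_id.sub_const _)
  | succ j => exact (hψ.comp ((measurable_id.const_mul _).sub_const _)).const_mul _

lemma abs_wavelet_le {φ ψ : ℝ → ℝ} {M : ℝ} (hφ : ∀ x, |φ x| ≤ M) (hψ : ∀ x, |ψ x| ≤ M)
    (l : ℕ) (k : ℤ) (x : ℝ) : |wavelet φ ψ l k x| ≤ M * √(scale l) := by
  cases l with
  | zero => simpa [wavelet, scale] using hφ _
  | succ j =>
    rw [sqrt_scale_succ, wavelet, abs_mul, abs_of_pos (by positivity), mul_comm]
    gcongr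
    exact hψ _

lemma abs_sub_le_of_wavelet_ne_zero {A : ℝ} {φ ψ : ℝ → ℝ}
    (hφ : ∀ x, x ∉ Icc (-A) A → φ x = 0) (hψ : ∀ x, x ∉ Icc (-A) A → ψ x = 0)
    {l : ℕ} {k : ℤ} {x : ℝ} (h : wavelet φ ψ l k x ≠ 0) :
    scale l * x - A ≤ k ∧ (k : ℝ) ≤ scale l * x + A := by
  have key : scale l * x - k ∈ Icc (-A) A := by
    by_contra hk
    refine h ?_
    cases l with
    | zero => exact hφ _ (by simpa [scale] using hk)
    | succ j =>
      rw [wavelet, hψ _ (by simpa [scale] using hk), mul_zero]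
  obtain ⟨h1, h2⟩ := key
  constructor <;> linarith

lemma card_le_of_forall_mem {s : Finset ℤ} {a b : ℝ} (hab : a ≤ b)
    (h : ∀ k ∈ s, a ≤ (k : ℝ) ∧ (k : ℝ) ≤ b) : (s.card : ℝ) ≤ b - a + 1 := by
  have hsub : s ⊆ Finset.Icc ⌈a⌉ ⌊b⌋ := fun k hk =>
    Finset.mem_Icc.2 ⟨Int.ceil_le.2 (h k hk).1, Int.le_floor.2 (h k hk).2⟩
  have hcard : (s.card : ℝ) ≤ ((⌊b⌋ + 1 - ⌈a⌉).toNat : ℝ) := by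
    exact_mod_cast (Finset.card_le_card hsub).trans_eq (Int.card_Icc _ _)
  refine hcard.trans ?_
  rcases le_total 0 (⌊b⌋ + 1 - ⌈a⌉) with h0 | h0
  · have : ((⌊b⌋ + 1 - ⌈a⌉).toNat : ℝ) = (⌊b⌋ : ℝ) + 1 - ⌈a⌉ := by
      exact_mod_cast Int.toNat_of_nonneg h0
    rw [this]
    linarith [Int.floor_le b, Int.le_ceil a]
  · rw [Int.toNat_of_nonpos h0]
    push_cast
    linarith

/-- At every point, at most `2A + 1` wavelets of one level do not vanish. -/
lemma sum_abs_wavelet_le {A M : ℝ} (hA : 0 < A) {φ ψ : ℝ → ℝ}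
    (hφ₀ : ∀ x, x ∉ Icc (-A) A → φ x = 0) (hψ₀ : ∀ x, x ∉ Icc (-A) A → ψ x = 0)
    (hφ : ∀ x, |φ x| ≤ M) (hψ : ∀ x, |ψ x| ≤ M) (l : ℕ) (s : Finset ℤ) (x : ℝ) :
    ∑ k ∈ s, |wavelet φ ψ l k x| ≤ (2 * A + 1) * M * √(scale l) := by
  have hM : 0 ≤ M := (abs_nonneg _).trans (hφ 0)
  rw [← Finset.sum_filter_of_ne (p := fun k => wavelet φ ψ l k x ≠ 0)
    (fun k _ hk => by simpa using hk)]
  refine (Finset.sum_le_card_nsmul _ _ _ fun k _ => abs_wavelet_le hφ hψ l k x).trans ?_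
  rw [nsmul_eq_mul, mul_assoc]
  gcongr
  have := card_le_of_forall_mem (s := s.filter fun k => wavelet φ ψ l k x ≠ 0)
    (a := scale l * x - A) (b := scale l * x + A) (by linarith)
    fun k hk => abs_sub_le_of_wavelet_ne_zero hφ₀ hψ₀ (Finset.mem_filter.1 hk).2
  linarith

lemma sum_range_scale (J : ℕ) : ∑ l ∈ Finset.range (J + 2), scale l = 2 * 2 ^ J := by
  induction J with
  | zero => simp [Finset.sum_range_succ, scale]; norm_num
  | succ J ih => rw [Finset.sum_range_succ, ih, scale]; ring

lemma sum_range_sqrt_scale_le (J : ℕ) :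
    ∑ l ∈ Finset.range (J + 2), √(scale l) ≤ 6 * √(2 ^ J) := by
  induction J with
  | zero => simp [Finset.sum_range_succ, scale]; norm_num
  | succ J ih =>
    rw [Finset.sum_range_succ, scale]
    have h2 : (6 : ℝ) / 5 ≤ √2 := Real.le_sqrt_of_sq_le (by norm_num)
    have h3 : √((2 : ℝ) ^ (J + 1)) = √(2 ^ J) * √2 := by
      rw [pow_succ, Real.sqrt_mul (by positivity)]
    rw [h3]
    nlinarith [Real.sqrt_nonneg ((2 : ℝ) ^ J)]

/-- The index sets of the levels up to `J` have in total at most a constant multiple of `2 ^ J`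
elements. -/
lemma card_sigma_le {A : ℝ} (hA : 0 < A) {N : ℕ → Finset ℤ}
    (hN : ∀ l, ∀ k ∈ N l, -A ≤ (k : ℝ) ∧ (k : ℝ) ≤ scale l + A) (J : ℕ) :
    ((((Finset.range (J + 2)).sigma N).card : ℕ) : ℝ) ≤ (4 * A + 4) * 2 ^ J := by
  rw [Finset.card_sigma, Nat.cast_sum]
  have h1 : ∀ l ∈ Finset.range (J + 2), ((N l).card : ℝ) ≤ scale l + (2 * A + 1) := fun l _ => by
    have := card_le_of_forall_mem (by linarith [scale_pos l]) (hN l)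
    linarith
  refine (Finset.sum_le_sum h1).trans ?_
  rw [Finset.sum_add_distrib, sum_range_scale, Finset.sum_const, Finset.card_range, nsmul_eq_mul]
  have h2 : ((J + 2 : ℕ) : ℝ) ≤ 2 * 2 ^ J := by
    have : J + 1 ≤ 2 ^ J := Nat.lt_two_pow_self
    have h3 : (1 : ℕ) ≤ 2 ^ J := Nat.one_le_two_pow
    have h4 : J + 2 ≤ 2 * 2 ^ J := by omega
    exact_mod_cast h4
  nlinarith

/-! ### Wavelet coefficients and the wavelet series -/

lemma abs_integral_wavelet_le {φ ψ : ℝ → ℝ} {M : ℝ} (hφ : ∀ x, |φ x| ≤ M) (hψ : ∀ x, |ψ x| ≤ M)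
    (G : Measure ℝ) [IsProbabilityMeasure G] (l : ℕ) (k : ℤ) :
    |∫ x, wavelet φ ψ l k x ∂G| ≤ M * √(scale l) := by
  simpa using norm_integral_le_of_norm_le_const (μ := G) (C := M * √(scale l))
    (f := wavelet φ ψ l k) (ae_of_all _ fun x => abs_wavelet_le hφ hψ l k x)

lemma integrable_of_integral_eq_one {f : ℝ → ℝ} (h : ∫ x, f x = 1) : Integrable f := by
  by_contra hf
  rw [integral_undef hf] at h
  exact zero_ne_one h

lemma abs_coeff_le {φ ψ f : ℝ → ℝ} {M : ℝ} (hφ : ∀ x, |φ x| ≤ M) (hψ : ∀ x, |ψ x| ≤ M)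
    (hf : ∀ x, 0 ≤ f x) (hf₁ : ∫ x, f x = 1) (l : ℕ) (k : ℤ) :
    |coeff φ ψ f l k| ≤ M * √(scale l) := by
  have h := norm_integral_le_of_norm_le (μ := volume) (f := fun x => f x * wavelet φ ψ l k x)
    ((integrable_of_integral_eq_one hf₁).mul_const (M * √(scale l))) (ae_of_all _ fun x => by
      rw [norm_mul, Real.norm_of_nonneg (hf x)]
      exact mul_le_mul_of_nonneg_left (abs_wavelet_le hφ hψ l k x) (hf x))
  rwa [integral_mul_const, hf₁, one_mul] at h

lemma abs_coeff_le_of_sobolevNormSq_le {φ ψ f : ℝ → ℝ} {β r : ℝ} (hr : 0 ≤ r)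
    (hs : Summable (sobolevTerm φ ψ β f)) (hn : sobolevNormSq φ ψ β f ≤ r ^ 2) (l : ℕ) (k : ℤ) :
    |coeff φ ψ f l k| ≤ r * ((2 : ℝ) ^ ((l : ℝ) - 1)) ^ (-β) := by
  set u : ℝ := (2 : ℝ) ^ ((l : ℝ) - 1) with hu
  have hu0 : 0 < u := by positivity
  have h1 : u ^ (2 * β) * coeff φ ψ f l k ^ 2 ≤ r ^ 2 :=
    (hs.le_tsum (l, k) fun p _ => by unfold sobolevTerm; positivity).trans hn
  have h2 : u ^ (2 * β) = (u ^ β) ^ 2 := by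
    rw [mul_comm, Real.rpow_mul hu0.le, Real.rpow_two]
  rw [h2, ← mul_pow] at h1
  have h3 := abs_le_of_sq_le_sq h1 hr
  rw [Real.rpow_neg hu0.le, ← div_eq_mul_inv, le_div_iff₀ (by positivity), mul_comm]
  calc u ^ β * |coeff φ ψ f l k| = |u ^ β * coeff φ ψ f l k| := by
        rw [abs_mul, abs_of_pos (Real.rpow_pos_of_pos hu0 β)]
    _ ≤ r := h3

/-- Absolute sums over rows control absolute sums over all finite sets of indices. -/
lemma sum_abs_le_tsum_of_rows {h : ℕ × ℤ → ℝ} {c : ℕ → ℝ} (hc : Summable c) (hc0 : ∀ l, 0 ≤ c l)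
    (hrow : ∀ l (t : Finset ℤ), ∑ k ∈ t, |h (l, k)| ≤ c l) (s : Finset (ℕ × ℤ)) :
    ∑ p ∈ s, |h p| ≤ ∑' l, c l := by
  classical
  calc ∑ p ∈ s, |h p| ≤ ∑ p ∈ s.image Prod.fst ×ˢ s.image Prod.snd, |h p| :=
        Finset.sum_le_sum_of_subset_of_nonneg Finset.subset_product fun _ _ _ => abs_nonneg _
    _ ≤ ∑ l ∈ s.image Prod.fst, c l := by
        rw [Finset.sum_product]
        exact Finset.sum_le_sum fun l _ => hrow l _
    _ ≤ _ := hc.sum_le_tsum _ fun l _ => hc0 l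

/-- A bound, decaying geometrically in the level when `β > 1/2`, for the absolute sum of one level
of the wavelet series of a function of Sobolev norm at most `r`. The factor `D` bounds the overlap
of the wavelets. -/
noncomputable def levelBound (D r β : ℝ) (l : ℕ) : ℝ :=
  r * ((2 : ℝ) ^ ((l : ℝ) - 1)) ^ (-β) * (D * √(scale l))

lemma levelBound_succ (D r β : ℝ) (j : ℕ) :
    levelBound D r β (j + 1) = D * r * ((2 : ℝ) ^ (1 / 2 - β)) ^ j := by
  rw [levelBound, sqrt_scale_succ, ← Real.rpow_natCast, ← Real.rpow_mul (by norm_num),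
    ← Real.rpow_mul (by norm_num),
    show (1 / 2 - β) * (j : ℝ) = (((j + 1 : ℕ) : ℝ) - 1) * -β + (j : ℝ) / 2 by push_cast; ring,
    Real.rpow_add (by norm_num)]
  ring

lemma levelBound_nonneg {D r : ℝ} (hD : 0 ≤ D) (hr : 0 ≤ r) (β : ℝ) (l : ℕ) :
    0 ≤ levelBound D r β l := by
  unfold levelBound; positivity

lemma two_rpow_half_sub_lt_one {β : ℝ} (hβ : 1 / 2 < β) : (2 : ℝ) ^ (1 / 2 - β) < 1 :=
  Real.rpow_lt_one_of_one_lt_of_neg (by norm_num) (by linarith)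

lemma hasSum_levelBound_tail (D r : ℝ) {β : ℝ} (hβ : 1 / 2 < β) (m : ℕ) :
    HasSum (fun i => levelBound D r β (i + m + 1))
      (D * r * ((2 : ℝ) ^ (1 / 2 - β)) ^ m * (1 - (2 : ℝ) ^ (1 / 2 - β))⁻¹) := by
  have h := (hasSum_geometric_of_lt_one (by positivity) (two_rpow_half_sub_lt_one hβ)).mul_left
    (D * r * ((2 : ℝ) ^ (1 / 2 - β)) ^ m)
  refine h.congr_fun fun i => ?_
  rw [levelBound_succ, pow_add]
  ring

lemma summable_levelBound (D r : ℝ) {β : ℝ} (hβ : 1 / 2 < β) : Summable (levelBound D r β) :=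
  (summable_nat_add_iff 1).1 (hasSum_levelBound_tail D r hβ 0).summable

section Series

variable {A M β r : ℝ} {φ ψ f : ℝ → ℝ}

lemma sum_abs_series_le (hA : 0 < A)
    (hφ₀ : ∀ x, x ∉ Icc (-A) A → φ x = 0) (hψ₀ : ∀ x, x ∉ Icc (-A) A → ψ x = 0)
    (hφ : ∀ x, |φ x| ≤ M) (hψ : ∀ x, |ψ x| ≤ M) (hr : 0 ≤ r)
    (hs : Summable (sobolevTerm φ ψ β f)) (hn : sobolevNormSq φ ψ β f ≤ r ^ 2)
    (l : ℕ) (t : Finset ℤ) (x : ℝ) :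
    ∑ k ∈ t, |coeff φ ψ f l k * wavelet φ ψ l k x| ≤ levelBound ((2 * A + 1) * M) r β l := by
  calc ∑ k ∈ t, |coeff φ ψ f l k * wavelet φ ψ l k x|
      ≤ ∑ k ∈ t, r * ((2 : ℝ) ^ ((l : ℝ) - 1)) ^ (-β) * |wavelet φ ψ l k x| := by
        refine Finset.sum_le_sum fun k _ => ?_
        rw [abs_mul]
        exact mul_le_mul_of_nonneg_right (abs_coeff_le_of_sobolevNormSq_le hr hs hn l k)
          (abs_nonneg _)
    _ ≤ _ := by
        rw [← Finset.mul_sum, levelBound]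
        exact mul_le_mul_of_nonneg_left (sum_abs_wavelet_le hA hφ₀ hψ₀ hφ hψ l t x)
          (by positivity)

/-- The bias from truncating the wavelet series after resolution level `J`. -/
lemma abs_sub_truncation_le (hA : 0 < A)
    (hφ₀ : ∀ x, x ∉ Icc (-A) A → φ x = 0) (hψ₀ : ∀ x, x ∉ Icc (-A) A → ψ x = 0)
    (hφ : ∀ x, |φ x| ≤ M) (hψ : ∀ x, |ψ x| ≤ M) (hβ : 1 / 2 < β) (hr : 0 ≤ r)
    (hs : Summable (sobolevTerm φ ψ β f)) (hn : sobolevNormSq φ ψ β f ≤ r ^ 2)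
    {N : ℕ → Finset ℤ} (hN : ∀ l k, coeff φ ψ f l k ≠ 0 → k ∈ N l) (J : ℕ) {x : ℝ}
    (hx : HasSum (fun p : ℕ × ℤ => coeff φ ψ f p.1 p.2 * wavelet φ ψ p.1 p.2 x) (f x)) :
    |∑ l ∈ Finset.range (J + 2), ∑ k ∈ N l, coeff φ ψ f l k * wavelet φ ψ l k x - f x| ≤
      (2 * A + 1) * M * r * ((2 : ℝ) ^ (1 / 2 - β)) ^ J * (1 - (2 : ℝ) ^ (1 / 2 - β))⁻¹ := by
  classical
  have hM : 0 ≤ M := (abs_nonneg _).trans (hφ 0)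
  set D := (2 * A + 1) * M with hD
  have hD0 : 0 ≤ D := by positivity
  set g : ℕ × ℤ → ℝ := fun p => coeff φ ψ f p.1 p.2 * wavelet φ ψ p.1 p.2 x with hg
  set g₀ : ℕ × ℤ → ℝ := fun p => if p.1 < J + 2 then g p else 0 with hg₀
  set g₁ : ℕ × ℤ → ℝ := fun p => if p.1 < J + 2 then 0 else g p with hg₁
  have hsum₀ : HasSum g₀ (∑ l ∈ Finset.range (J + 2), ∑ k ∈ N l, g (l, k)) := by
    have hS : ∑ l ∈ Finset.range (J + 2), ∑ k ∈ N l, g (l, k) =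
        ∑ p ∈ ((Finset.range (J + 2)).sigma N).image (fun q => (q.1, q.2)), g₀ p := by
      rw [Finset.sum_image (by rintro ⟨a, b⟩ _ ⟨c, d⟩ _ h; simpa using h), Finset.sum_sigma]
      refine Finset.sum_congr rfl fun l hl => Finset.sum_congr rfl fun k _ => ?_
      simp only [hg₀, if_pos (Finset.mem_range.1 hl)]
    rw [hS]
    refine hasSum_sum_of_ne_finset_zero fun p hp => ?_
    by_contra h
    rw [hg₀] at h
    simp only [ite_eq_right_iff, not_forall] at h
    obtain ⟨hlt, hne⟩ := h
    exact hp (Finset.mem_image.2 ⟨⟨p.1, p.2⟩,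
      Finset.mem_sigma.2 ⟨Finset.mem_range.2 hlt, hN _ _ (left_ne_zero_of_mul hne)⟩, rfl⟩)
  have hsum₁ : HasSum g₁ (f x - ∑ l ∈ Finset.range (J + 2), ∑ k ∈ N l, g (l, k)) := by
    refine (hx.sub hsum₀).congr_fun fun p => ?_
    simp only [hg₁, hg₀]
    split_ifs <;> simp
  set c : ℕ → ℝ := fun l => if l < J + 2 then 0 else levelBound D r β l with hc
  have hcsum : HasSum c (D * r * ((2 : ℝ) ^ (1 / 2 - β)) ^ (J + 1) *
      (1 - (2 : ℝ) ^ (1 / 2 - β))⁻¹) := by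
    rw [← hasSum_nat_add_iff' (J + 2), Finset.sum_eq_zero (fun l hl => by
      simp [hc, Finset.mem_range.1 hl]), sub_zero]
    refine (hasSum_levelBound_tail D r hβ (J + 1)).congr_fun fun i => ?_
    simp only [hc, if_neg (show ¬ i + (J + 2) < J + 2 by omega)]
    rfl
  have hfin := sum_abs_le_tsum_of_rows (h := g₁) hcsum.summable
    (fun l => by
      simp only [hc]
      split_ifs
      exacts [le_rfl, levelBound_nonneg hD0 hr β l])
    (fun l t => by
      simp only [hc, hg₁]
      split_ifs
      · simp
      · exact sum_abs_series_le hA hφ₀ hψ₀ hφ hψ hr hs hn l t x)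
  rw [hcsum.tsum_eq] at hfin
  rw [abs_sub_comm]
  refine (le_of_tendsto hsum₁.abs (Filter.Eventually.of_forall fun s =>
    (Finset.abs_sum_le_sum_abs _ _).trans (hfin s))).trans ?_
  have hρ := two_rpow_half_sub_lt_one hβ
  have : 0 ≤ (1 - (2 : ℝ) ^ (1 / 2 - β))⁻¹ := inv_nonneg.2 (by linarith)
  gcongr ?_ * _
  exact mul_le_mul_of_nonneg_left
    (pow_le_pow_of_le_one (by positivity) hρ.le J.le_succ) (by positivity)

/-- The wavelet series converges to `f` almost everywhere: its partial sums converge in `L²`, hence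
almost everywhere along a subsequence, and it converges absolutely at every point. -/
lemma ae_hasSum_series (hA : 0 < A) (hw : IsWaveletPair A φ ψ)
    (hφ : ∀ x, |φ x| ≤ M) (hψ : ∀ x, |ψ x| ≤ M) (hβ : 1 / 2 < β) (hr : 0 ≤ r)
    (hf₂ : MemLp f 2 volume)
    (hs : Summable (sobolevTerm φ ψ β f)) (hn : sobolevNormSq φ ψ β f ≤ r ^ 2) :
    ∀ᵐ x, HasSum (fun p : ℕ × ℤ => coeff φ ψ f p.1 p.2 * wavelet φ ψ p.1 p.2 x) (f x) := by
  have hM : 0 ≤ M := (abs_nonneg _).trans (hφ 0)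
  obtain ⟨b, hb⟩ := hw.basis
  have hrepr : ∀ p, b.repr (hf₂.toLp f) p = coeff φ ψ f p.1 p.2 := fun p => by
    rw [b.repr_apply_apply, L2.inner_def, coeff]
    refine integral_congr_ae ?_
    filter_upwards [hb p, hf₂.coeFn_toLp] with x h1 h2
    rw [h1, h2]
    simp
  have hL2 := b.hasSum_repr (hf₂.toLp f)
  obtain ⟨ns, hns, hae⟩ := (tendstoInMeasure_of_tendsto_Lp hL2).exists_seq_tendsto_ae'
  have hpart : ∀ s : Finset (ℕ × ℤ),
      ((∑ p ∈ s, b.repr (hf₂.toLp f) p • b p : Lp ℝ 2 (volume : Measure ℝ)) : ℝ → ℝ) =ᵐ[volume]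
        fun x => ∑ p ∈ s, coeff φ ψ f p.1 p.2 * wavelet φ ψ p.1 p.2 x := fun s => by
    classical
    induction s using Finset.induction_on with
    | empty =>
      simp only [Finset.sum_empty]
      exact Lp.coeFn_zero ℝ 2 volume
    | insert p s hp ih =>
      simp only [Finset.sum_insert hp]
      filter_upwards [ih, hb p, Lp.coeFn_add (b.repr (hf₂.toLp f) p • b p)
        (∑ p ∈ s, b.repr (hf₂.toLp f) p • b p),
        Lp.coeFn_smul (b.repr (hf₂.toLp f) p) (b p)] with x h1 h2 h3 h4
      rw [h3, Pi.add_apply, h1, h4, Pi.smul_apply, h2, hrepr, smul_eq_mul]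
  filter_upwards [hae, hf₂.coeFn_toLp, ae_all_iff.2 fun n => hpart (ns n)] with x h1 h2 h3
  have hsum : Summable fun p : ℕ × ℤ => coeff φ ψ f p.1 p.2 * wavelet φ ψ p.1 p.2 x := by
    refine Summable.of_abs (summable_of_sum_le (fun _ => abs_nonneg _) (c := ∑' l,
      levelBound ((2 * A + 1) * M) r β l) ?_)
    exact sum_abs_le_tsum_of_rows (summable_levelBound _ r hβ)
      (levelBound_nonneg (by positivity) hr β) fun l t =>
        sum_abs_series_le hA hw.father_eq_zero hw.mother_eq_zero hφ hψ hr hs hn l t x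
  have h4 := hsum.hasSum.comp hns
  simp only [h3, h2] at h1
  rw [← tendsto_nhds_unique h4 h1]
  exact hsum.hasSum

end Series

/-- The mean of a wavelet under the contaminated distribution. -/
lemma integral_wavelet_contaminated {φ ψ f : ℝ → ℝ} (hφm : Measurable φ) (hψm : Measurable ψ)
    {M : ℝ} (hφ : ∀ x, |φ x| ≤ M) (hψ : ∀ x, |ψ x| ≤ M)
    (hf : ∀ x, 0 ≤ f x) (hf₁ : ∫ x, f x = 1) {ε : ℝ} (hε : ε ∈ Icc (0 : ℝ) 1)
    (G : Measure ℝ) [IsProbabilityMeasure G] (l : ℕ) (k : ℤ) :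
    ∫ x, wavelet φ ψ l k x ∂(contaminated ε f G) =
      (1 - ε) * coeff φ ψ f l k + ε * ∫ x, wavelet φ ψ l k x ∂G := by
  have hfi := integrable_of_integral_eq_one hf₁
  have : IsFiniteMeasure (volume.withDensity fun x => ENNReal.ofReal (f x)) :=
    isFiniteMeasure_withDensity_ofReal hfi.2
  have hint : ∀ μ : Measure ℝ, IsFiniteMeasure μ → Integrable (wavelet φ ψ l k) μ := fun μ _ =>
    .of_bound (measurable_wavelet hφm hψm l k).aestronglyMeasurable (M * √(scale l))
      (ae_of_all _ fun x => abs_wavelet_le hφ hψ l k x)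
  rw [contaminated, integral_add_measure
    ((hint _ inferInstance).smul_measure ENNReal.ofReal_ne_top)
    ((hint _ inferInstance).smul_measure ENNReal.ofReal_ne_top), integral_smul_measure,
    integral_smul_measure, ENNReal.toReal_ofReal (by linarith [hε.2]),
    ENNReal.toReal_ofReal hε.1,
    integral_withDensity_eq_integral_toReal_smul₀ hfi.1.aemeasurable.ennreal_ofReal
      (ae_of_all _ fun _ => ENNReal.ofReal_lt_top), smul_eq_mul, smul_eq_mul, coeff]
  simp only [ENNReal.toReal_ofReal (hf _), smul_eq_mul]

/-! ### The stochastic error -/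

lemma lintegral_exp_mul_comp {Ω : Type*} [MeasurableSpace Ω] {P : Measure Ω} {Y : Ω → ℝ}
    {μ : Measure ℝ} (h : HasLaw Y μ P) (t : ℝ) :
    ∫⁻ ω, ENNReal.ofReal (Real.exp (t * Y ω)) ∂P =
      ∫⁻ x, ENNReal.ofReal (Real.exp (t * x)) ∂μ := by
  rw [← h.map_eq, lintegral_map' (by fun_prop) h.aemeasurable]

/-- The errors `β̂_{jk} - E β̂_{jk}` of all the coefficients in use are dominated by a single random
variable whose mean is controlled by the number of coefficients. Divided by `M 2^{J/2} / α`, the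
summands of `β̂_{jk}` split into a wavelet part with values in `[-1, 1]` and a Laplace part with
factor at most one, so that both have exponential moment at most `exp (2 t²)` for `t ≤ 1/2`. -/
lemma exists_stochastic_bound {A M α ε : ℝ} {φ ψ f : ℝ → ℝ} {G : Measure ℝ} {J n : ℕ}
    (hn : 0 < n) (hφm : Measurable φ) (hψm : Measurable ψ)
    (hφ : ∀ x, |φ x| ≤ M) (hψ : ∀ x, |ψ x| ≤ M) (hM : 0 < M) (hα : α ∈ Ioo (0 : ℝ) 1)
    (hnoise : |noiseLevel A ψ α J| ≤ M * √(2 ^ J) / α) {N : ℕ → Finset ℤ}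
    {Ω : Type*} [MeasurableSpace Ω] {P : Measure Ω} [IsProbabilityMeasure P]
    {X : Fin n → Ω → ℝ} {W : Fin n → ℕ → ℤ → Ω → ℝ}
    (hX : ∀ i, HasLaw (X i) (contaminated ε f G) P)
    (hW : ∀ i l k, HasLaw (W i l k) stdLaplace P)
    (hind : iIndepFun (Sum.elim X (fun p : Fin n × ℕ × ℤ => W p.1 p.2.1 p.2.2)) P)
    {t a : ℝ} (ht : 0 < t) (ht₂ : t ≤ 1 / 2) (ha : 0 ≤ a)
    (hcard : 2 * (((Finset.range (J + 2)).sigma N).card : ℝ) * Real.exp (4 * n * t ^ 2) ≤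
      Real.exp a) :
    ∃ R : Ω → ℝ, (∀ ω, 0 ≤ R ω) ∧
      (∀ l < J + 2, ∀ k ∈ N l, ∀ ω,
        |privCoeff A φ ψ α J (fun i => X i ω) (fun i l k => W i l k ω) l k -
          ∫ x, wavelet φ ψ l k x ∂(contaminated ε f G)| ≤ M * √(2 ^ J) / α / n * R ω) ∧
      ∫⁻ ω, ENNReal.ofReal (R ω) ∂P ≤ ENNReal.ofReal ((a + 1) / t) := by
  obtain ⟨hα0, hα1⟩ := hα
  have hn' : (0 : ℝ) < n := by exact_mod_cast hn
  set s : ℝ := M * √(2 ^ J) / α with hs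
  have hs0 : 0 < s := by positivity
  set b : ℝ := noiseLevel A ψ α J / s with hb
  have hb1 : |b| ≤ 1 := by
    rw [hb, abs_div, abs_of_pos hs0]
    exact div_le_one_of_le₀ hnoise hs0.le
  set m : ℕ → ℤ → ℝ := fun l k => ∫ x, wavelet φ ψ l k x ∂(contaminated ε f G) with hm
  set g : ℕ → ℤ → Fin n ⊕ Fin n → ℝ → ℝ := fun l k =>
    Sum.elim (fun _ x => s⁻¹ * wavelet φ ψ l k x - s⁻¹ * m l k) (fun _ w => b * w) with hg
  have hgm : ∀ l k q, Measurable (g l k q) := by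
    rintro l k (i | i)
    · exact ((measurable_wavelet hφm hψm l k).const_mul _).sub_const _
    · exact measurable_id.const_mul b
  set V : ℕ → ℤ → Fin n ⊕ Fin n → Ω → ℝ := fun l k =>
    Sum.elim X (fun i => W i l k) with hV
  have hVm : ∀ l k q, AEMeasurable (V l k q) P := by
    rintro l k (i | i)
    exacts [(hX i).aemeasurable, (hW i l k).aemeasurable]
  have hVind : ∀ l k, iIndepFun (V l k) P := fun l k => by
    have hinj : Function.Injective
        (Sum.map id (fun i => (i, l, k)) : Fin n ⊕ Fin n → Fin n ⊕ (Fin n × ℕ × ℤ)) :=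
      Function.injective_id.sumMap fun i j h => (Prod.ext_iff.1 h).1
    have := hind.precomp hinj
    convert this using 1
    funext q
    rcases q with i | i <;> rfl
  have hZind : ∀ l k, iIndepFun (fun q => g l k q ∘ V l k q) P := fun l k =>
    (hVind l k).comp _ (hgm l k)
  have hZm : ∀ l k q, AEMeasurable (g l k q ∘ V l k q) P := fun l k q =>
    (hgm l k q).comp_aemeasurable (hVm l k q)
  set S : (Σ _ : ℕ, ℤ) → Ω → ℝ := fun p ω => ∑ q, (g p.1 p.2 q ∘ V p.1 p.2 q) ω with hS
  have hSm : ∀ p, AEMeasurable (S p) P := fun p =>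
    Finset.aemeasurable_fun_sum _ fun q _ => hZm p.1 p.2 q
  have hexp : ∀ u : ℝ, |u| = t → ∀ p ∈ (Finset.range (J + 2)).sigma N,
      ∫⁻ ω, ENNReal.ofReal (Real.exp (u * S p ω)) ∂P ≤
        ENNReal.ofReal (Real.exp (4 * n * t ^ 2)) := by
    rintro u hu ⟨l, k⟩ hp
    have hl : l < J + 2 := Finset.mem_range.1 (Finset.mem_sigma.1 hp).1
    have hu2 : u ^ 2 = t ^ 2 := by rw [← sq_abs, hu]
    have h := lintegral_exp_mul_sum_le (t := u) (c := 2 * t ^ 2) (hZind l k) (hZm l k) (by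
      rintro (i | i)
      · have hY : AEMeasurable (fun ω => s⁻¹ * wavelet φ ψ l k (X i ω)) P :=
          ((measurable_wavelet hφm hψm l k).comp_aemeasurable (hX i).aemeasurable).const_mul _
        have hYb : ∀ ω, |s⁻¹ * wavelet φ ψ l k (X i ω)| ≤ 1 := fun ω => by
          rw [abs_mul, abs_of_pos (inv_pos.2 hs0), ← div_eq_inv_mul]
          refine div_le_one_of_le₀ ((abs_wavelet_le hφ hψ l k _).trans ?_) hs0.le
          have h1 : √(scale l) ≤ √(2 ^ J) := Real.sqrt_le_sqrt (scale_mono (Nat.lt_succ_iff.1 hl))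
          refine (mul_le_mul_of_nonneg_left h1 hM.le).trans (le_div_self (by positivity) hα0 hα1.le)
        have hmean : ∫ ω, s⁻¹ * wavelet φ ψ l k (X i ω) ∂P = s⁻¹ * m l k := by
          rw [integral_const_mul, hm]
          simp only
          rw [← (hX i).map_eq, integral_map (hX i).aemeasurable
            (measurable_wavelet hφm hψm l k).aestronglyMeasurable]
        have := lintegral_exp_mul_le_of_abs_le hY hYb u
        rw [hmean, hu2] at this
        exact this
      · have h1 := lintegral_exp_mul_stdLaplace_le (t := u * b) (by
          rw [abs_mul, hu]
          exact (mul_le_of_le_one_right ht.le hb1).trans ht₂)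
        rw [← lintegral_exp_mul_comp (hW i l k)] at h1
        simp only [mul_assoc] at h1
        refine h1.trans (ENNReal.ofReal_le_ofReal (Real.exp_le_exp.2 ?_))
        have : b ^ 2 ≤ 1 := (sq_le_one_iff_abs_le_one b).2 hb1
        rw [mul_pow, hu2]
        nlinarith [sq_nonneg t])
    refine h.trans_eq ?_
    rw [Fintype.card_sum, Fintype.card_fin]
    push_cast
    ring_nf
  obtain ⟨R, hR0, hR, hRint⟩ := exists_dominating ((Finset.range (J + 2)).sigma N) hSm ht ha
    (hexp t (abs_of_pos ht)) (hexp (-t) (by rw [abs_neg, abs_of_pos ht])) hcard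
  refine ⟨R, hR0, fun l hl k hk ω => ?_, hRint⟩
  have hSR := hR ⟨l, k⟩ (Finset.mem_sigma.2 ⟨Finset.mem_range.2 hl, hk⟩) ω
  have hid : privCoeff A φ ψ α J (fun i => X i ω) (fun i l k => W i l k ω) l k - m l k =
      s / n * S ⟨l, k⟩ ω := by
    have : S ⟨l, k⟩ ω = ∑ i : Fin n, (s⁻¹ * wavelet φ ψ l k (X i ω) - s⁻¹ * m l k) +
        ∑ i : Fin n, b * W i l k ω := by
      simp only [hS, Fintype.sum_sum_type]
      rfl
    rw [this, privCoeff, Finset.sum_sub_distrib, Finset.sum_add_distrib, hb]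
    simp only [← Finset.mul_sum, Finset.sum_const, Finset.card_univ, Fintype.card_fin,
      nsmul_eq_mul]
    field_simp
    ring
  rw [hid, abs_mul, abs_of_pos (by positivity)]
  gcongr

/-! ### Decomposition of the loss -/

/-- Pointwise decomposition of the loss into the stochastic error, the bias due to contamination
and the truncation bias. -/
lemma abs_fLap_sub_le {A M α β r ε : ℝ} {φ ψ f : ℝ → ℝ} {G : Measure ℝ} [IsProbabilityMeasure G]
    {J n : ℕ} (hA : 0 < A) (hφm : Measurable φ) (hψm : Measurable ψ)
    (hφ₀ : ∀ x, x ∉ Icc (-A) A → φ x = 0) (hψ₀ : ∀ x, x ∉ Icc (-A) A → ψ x = 0)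
    (hφ : ∀ x, |φ x| ≤ M) (hψ : ∀ x, |ψ x| ≤ M) (hβ : 1 / 2 < β) (hr : 0 ≤ r)
    (hε : ε ∈ Icc (0 : ℝ) 1) (hf : ∀ x, 0 ≤ f x) (hf₁ : ∫ x, f x = 1)
    (hs : Summable (sobolevTerm φ ψ β f)) (hnorm : sobolevNormSq φ ψ β f ≤ r ^ 2)
    {N : ℕ → Finset ℤ} (hN : ∀ l k, coeff φ ψ f l k ≠ 0 → k ∈ N l)
    {X : Fin n → ℝ} {W : Fin n → ℕ → ℤ → ℝ} {R : ℝ} (hR₀ : 0 ≤ R)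
    (hR : ∀ l < J + 2, ∀ k ∈ N l, |privCoeff A φ ψ α J X W l k -
      ∫ x, wavelet φ ψ l k x ∂(contaminated ε f G)| ≤ R) {x : ℝ}
    (hx : HasSum (fun p : ℕ × ℤ => coeff φ ψ f p.1 p.2 * wavelet φ ψ p.1 p.2 x) (f x)) :
    |fLap A φ ψ α J N X W x - f x| ≤ 6 * ((2 * A + 1) * M) * √(2 ^ J) * R +
      (4 * ((2 * A + 1) * M) * M * (ε * 2 ^ J) +
      (2 * A + 1) * M * r * ((2 : ℝ) ^ (1 / 2 - β)) ^ J * (1 - (2 : ℝ) ^ (1 / 2 - β))⁻¹) := by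
  have hM : 0 ≤ M := (abs_nonneg _).trans (hφ 0)
  have htr := abs_sub_truncation_le hA hφ₀ hψ₀ hφ hψ hβ hr hs hnorm hN J hx
  set D := (2 * A + 1) * M with hD
  have hD0 : 0 ≤ D := by positivity
  have hcoef : ∀ l < J + 2, ∀ k ∈ N l,
      |privCoeff A φ ψ α J X W l k - coeff φ ψ f l k| ≤ R + 2 * ε * M * √(scale l) := by
    intro l hl k hk
    have h1 := hR l hl k hk
    rw [integral_wavelet_contaminated hφm hψm hφ hψ hf hf₁ hε G] at h1
    have h2 := abs_integral_wavelet_le hφ hψ G l k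
    have h3 := abs_coeff_le hφ hψ hf hf₁ l k
    have h4 : |ε * (∫ x, wavelet φ ψ l k x ∂G - coeff φ ψ f l k)| ≤ ε * (2 * (M * √(scale l))) := by
      rw [abs_mul, abs_of_nonneg hε.1]
      refine mul_le_mul_of_nonneg_left ((abs_sub _ _).trans ?_) hε.1
      linarith
    calc |privCoeff A φ ψ α J X W l k - coeff φ ψ f l k|
        = |(privCoeff A φ ψ α J X W l k -
            ((1 - ε) * coeff φ ψ f l k + ε * ∫ x, wavelet φ ψ l k x ∂G)) +
            ε * (∫ x, wavelet φ ψ l k x ∂G - coeff φ ψ f l k)| := by congr 1; ring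
      _ ≤ _ := (abs_add_le _ _).trans (by linarith)
  have hest : |fLap A φ ψ α J N X W x -
      ∑ l ∈ Finset.range (J + 2), ∑ k ∈ N l, coeff φ ψ f l k * wavelet φ ψ l k x| ≤
      6 * D * √(2 ^ J) * R + 4 * D * M * (ε * 2 ^ J) := by
    rw [fLap, ← Finset.sum_sub_distrib]
    calc |∑ l ∈ Finset.range (J + 2), (∑ k ∈ N l, privCoeff A φ ψ α J X W l k *
          wavelet φ ψ l k x - ∑ k ∈ N l, coeff φ ψ f l k * wavelet φ ψ l k x)|
        ≤ ∑ l ∈ Finset.range (J + 2), (R + 2 * ε * M * √(scale l)) * (D * √(scale l)) := by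
          refine (Finset.abs_sum_le_sum_abs _ _).trans (Finset.sum_le_sum fun l hl => ?_)
          rw [← Finset.sum_sub_distrib]
          have hε0 := hε.1
          calc |∑ k ∈ N l, (privCoeff A φ ψ α J X W l k * wavelet φ ψ l k x -
                coeff φ ψ f l k * wavelet φ ψ l k x)|
              ≤ ∑ k ∈ N l, (R + 2 * ε * M * √(scale l)) * |wavelet φ ψ l k x| := by
                refine (Finset.abs_sum_le_sum_abs _ _).trans (Finset.sum_le_sum fun k hk => ?_)
                rw [← sub_mul, abs_mul]
                exact mul_le_mul_of_nonneg_right (hcoef l (Finset.mem_range.1 hl) k hk)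
                  (abs_nonneg _)
            _ ≤ _ := by
                rw [← Finset.mul_sum]
                exact mul_le_mul_of_nonneg_left
                  (sum_abs_wavelet_le hA hφ₀ hψ₀ hφ hψ l (N l) x) (by positivity)
      _ = D * R * ∑ l ∈ Finset.range (J + 2), √(scale l) +
            2 * ε * M * D * ∑ l ∈ Finset.range (J + 2), scale l := by
          rw [Finset.mul_sum, Finset.mul_sum, ← Finset.sum_add_distrib]
          refine Finset.sum_congr rfl fun l _ => ?_
          linear_combination (2 * ε * M * D) * Real.mul_self_sqrt (scale_pos l).le
      _ ≤ D * R * (6 * √(2 ^ J)) + 2 * ε * M * D * (2 * 2 ^ J) := by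
          rw [sum_range_scale]
          gcongr
          exact sum_range_sqrt_scale_le J
      _ = _ := by ring
  calc _ ≤ _ := abs_sub_le _ (∑ l ∈ Finset.range (J + 2), ∑ k ∈ N l,
        coeff φ ψ f l k * wavelet φ ψ l k x) _
    _ ≤ _ := by linarith

/-! ### Rates -/

section Rates

variable {β c₁ c₂ α ε : ℝ} {n J : ℕ}

lemma log_ratio_pos {N : ℝ} (hN : 2 ≤ N) : 0 < Real.log N / N :=
  div_pos (Real.log_pos (by linarith)) (by linarith)

lemma resolutionRate_le : resolutionRate β n α ε ≤
    (Real.log (n * α ^ 2) / (n * α ^ 2)) ^ (-(1 / (2 * β + 1))) := by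
  unfold resolutionRate
  split_ifs
  exacts [le_rfl, min_le_left _ _]

lemma resolutionRate_pos (hN : 2 ≤ (n : ℝ) * α ^ 2) (hε : 0 ≤ ε) :
    0 < resolutionRate β n α ε := by
  have h := Real.rpow_pos_of_pos (log_ratio_pos hN) (-(1 / (2 * β + 1)))
  unfold resolutionRate
  split_ifs with h0
  · exact h
  · exact lt_min h (Real.rpow_pos_of_pos (lt_of_le_of_ne hε (Ne.symm h0)) _)

lemma riskRate_nonneg (hε : 0 ≤ ε) : 0 ≤ riskRate β n α ε :=
  (Real.rpow_nonneg hε _).trans (le_max_right _ _)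

lemma two_pow_mul_sqrt_le (hβ : 1 / 2 < β) (hN : 2 ≤ (n : ℝ) * α ^ 2) (hc₂ : 0 < c₂)
    (hJ : (2 : ℝ) ^ J ≤ c₂ * resolutionRate β n α ε) :
    2 ^ J * √(Real.log (n * α ^ 2) / (n * α ^ 2)) ≤ c₂ * riskRate β n α ε := by
  have hτ := log_ratio_pos hN
  set τ := Real.log (n * α ^ 2) / (n * α ^ 2) with hτd
  calc 2 ^ J * √τ ≤ c₂ * τ ^ (-(1 / (2 * β + 1))) * √τ :=
        mul_le_mul_of_nonneg_right
          (hJ.trans (mul_le_mul_of_nonneg_left resolutionRate_le hc₂.le)) (Real.sqrt_nonneg _)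
    _ = c₂ * τ ^ ((2 * β - 1) / (4 * β + 2)) := by
        rw [Real.sqrt_eq_rpow, mul_assoc, ← Real.rpow_add hτ]
        congr 2
        have : 2 * β + 1 ≠ 0 := by linarith
        have : 4 * β + 2 ≠ 0 := by linarith
        field_simp
        ring
    _ ≤ _ := mul_le_mul_of_nonneg_left (le_max_left _ _) hc₂.le

lemma mul_two_pow_le (hβ : 1 / 2 < β) (hc₂ : 0 < c₂) (hε : 0 ≤ ε)
    (hJ : (2 : ℝ) ^ J ≤ c₂ * resolutionRate β n α ε) :
    ε * 2 ^ J ≤ c₂ * riskRate β n α ε := by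
  rcases hε.eq_or_lt with rfl | hε0
  · rw [zero_mul]
    exact mul_nonneg hc₂.le (riskRate_nonneg le_rfl)
  have hT : resolutionRate β n α ε ≤ ε ^ (-(2 / (2 * β + 1))) := by
    rw [resolutionRate, if_neg hε0.ne']
    exact min_le_right _ _
  calc ε * 2 ^ J ≤ ε ^ (1 : ℝ) * (c₂ * ε ^ (-(2 / (2 * β + 1)))) := by
        rw [Real.rpow_one]
        exact mul_le_mul_of_nonneg_left (hJ.trans (mul_le_mul_of_nonneg_left hT hc₂.le)) hε
    _ = c₂ * ε ^ ((2 * β - 1) / (2 * β + 1)) := by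
        rw [mul_left_comm, ← Real.rpow_add hε0]
        congr 2
        have : 2 * β + 1 ≠ 0 := by linarith
        field_simp
        ring
    _ ≤ _ := mul_le_mul_of_nonneg_left (le_max_right _ _) hc₂.le

lemma two_rpow_half_sub_pow_le (hβ : 1 / 2 < β) (hN : 2 ≤ (n : ℝ) * α ^ 2) (hc₁ : 0 < c₁)
    (hε : 0 ≤ ε) (hJ : c₁ * resolutionRate β n α ε ≤ (2 : ℝ) ^ J) :
    ((2 : ℝ) ^ (1 / 2 - β)) ^ J ≤ c₁ ^ (1 / 2 - β) * riskRate β n α ε := by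
  have hτ := log_ratio_pos hN
  have hT := resolutionRate_pos (β := β) hN hε
  have hp : 2 * β + 1 ≠ 0 := by linarith
  have hp' : 4 * β + 2 ≠ 0 := by linarith
  have h1 : ((Real.log (n * α ^ 2) / (n * α ^ 2)) ^ (-(1 / (2 * β + 1)))) ^ (1 / 2 - β) =
      (Real.log (n * α ^ 2) / (n * α ^ 2)) ^ ((2 * β - 1) / (4 * β + 2)) := by
    rw [← Real.rpow_mul hτ.le]
    congr 1
    field_simp
    ring
  have h2 : (ε ^ (-(2 / (2 * β + 1)))) ^ (1 / 2 - β) = ε ^ ((2 * β - 1) / (2 * β + 1)) := by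
    rw [← Real.rpow_mul hε]
    congr 1
    field_simp
    ring
  calc ((2 : ℝ) ^ (1 / 2 - β)) ^ J = ((2 : ℝ) ^ J) ^ (1 / 2 - β) := by
        rw [← Real.rpow_natCast, ← Real.rpow_natCast, ← Real.rpow_mul (by norm_num), mul_comm,
          Real.rpow_mul (by norm_num)]
    _ ≤ (c₁ * resolutionRate β n α ε) ^ (1 / 2 - β) :=
        Real.rpow_le_rpow_of_nonpos (by positivity) hJ (by linarith)
    _ = c₁ ^ (1 / 2 - β) * resolutionRate β n α ε ^ (1 / 2 - β) :=
        Real.mul_rpow hc₁.le hT.le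
    _ ≤ _ := by
        refine mul_le_mul_of_nonneg_left ?_ (by positivity)
        unfold resolutionRate
        split_ifs with h0
        · exact h1.trans_le (le_max_left _ _)
        · rcases min_choice ((Real.log (n * α ^ 2) / (n * α ^ 2)) ^ (-(1 / (2 * β + 1))))
            (ε ^ (-(2 / (2 * β + 1)))) with h | h <;> rw [h]
          · exact h1.trans_le (le_max_left _ _)
          · exact h2.trans_le (le_max_right _ _)

/-- The resolution level is at most a multiple of `log (n α²)`. -/
lemma exists_level_le_mul_log (hβ : 1 / 2 < β) (hc₂ : 0 < c₂) :
    ∃ K : ℝ, 1 ≤ K ∧ ∀ (n : ℕ) (α ε : ℝ) (J : ℕ), 2 ≤ (n : ℝ) * α ^ 2 →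
      (2 : ℝ) ^ J ≤ c₂ * resolutionRate β n α ε → (J : ℝ) ≤ K * Real.log (n * α ^ 2) := by
  have hl0 : 0 < Real.log 2 := Real.log_pos (by norm_num)
  have hl1 : Real.log 2 ≤ 1 := by linarith [Real.log_two_lt_d9]
  set B := |Real.log c₂| + |Real.log (Real.log 2)| with hB
  have hB0 : 0 ≤ B := by positivity
  refine ⟨(B / Real.log 2 + 1) / Real.log 2, ?_, fun n α ε J hN hJ => ?_⟩
  · rw [one_le_div hl0]
    have : 0 ≤ B / Real.log 2 := by positivity
    linarith
  set N := (n : ℝ) * α ^ 2 with hNd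
  have hτ := log_ratio_pos hN
  have hlN : Real.log 2 ≤ Real.log N := Real.log_le_log (by norm_num) hN
  have h1 : (2 : ℝ) ^ J ≤ c₂ * (Real.log N / N) ^ (-(1 / (2 * β + 1))) :=
    hJ.trans (mul_le_mul_of_nonneg_left resolutionRate_le hc₂.le)
  have h2 := Real.log_le_log (by positivity) h1
  rw [Real.log_pow, Real.log_mul hc₂.ne' (Real.rpow_pos_of_pos hτ _).ne', Real.log_rpow hτ,
    Real.log_div (hl0.trans_le hlN).ne' (by linarith)] at h2
  have hp0 : 0 ≤ 1 / (2 * β + 1) := by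
    have : 0 < 2 * β + 1 := by linarith
    positivity
  have hp1 : 1 / (2 * β + 1) ≤ 1 := by
    rw [div_le_one (by linarith)]
    linarith
  have h3 : Real.log (Real.log 2) ≤ Real.log (Real.log N) := Real.log_le_log hl0 hlN
  have h4 : Real.log N - Real.log (Real.log N) ≤ Real.log N + |Real.log (Real.log 2)| := by
    linarith [neg_abs_le (Real.log (Real.log 2))]
  have h5 : 1 / (2 * β + 1) * (Real.log N - Real.log (Real.log N)) ≤
      Real.log N + |Real.log (Real.log 2)| := by
    refine (mul_le_mul_of_nonneg_left h4 hp0).trans (mul_le_of_le_one_left ?_ hp1)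
    have := hl0.trans_le hlN
    positivity
  have h6 : J * Real.log 2 ≤ B + Real.log N := by
    linarith [le_abs_self (Real.log c₂)]
  have h7 : B ≤ B / Real.log 2 * Real.log N := by
    rw [div_mul_eq_mul_div, le_div_iff₀ hl0]
    exact mul_le_mul_of_nonneg_left hlN hB0
  rw [div_mul_eq_mul_div, le_div_iff₀ hl0]
  linarith

end Rates

/-! ### The risk bound -/

/-- The order of the stochastic error for the choice `t ∼ √(J / n)` of the exponent. -/
lemma stochastic_order_le {β c₂ α ε K : ℝ} {n J : ℕ} (hn : 0 < (n : ℝ)) (hα : 0 < α)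
    (hβ : 1 / 2 < β) (hN : 2 ≤ (n : ℝ) * α ^ 2) (hc₂ : 0 < c₂) (hK : 1 ≤ K) (hJ₁ : 1 ≤ J)
    (hJ : (2 : ℝ) ^ J ≤ c₂ * resolutionRate β n α ε)
    (hJK : (J : ℝ) ≤ K * Real.log (n * α ^ 2)) :
    √(2 ^ J) * √(2 ^ J) / α / n * (J / (√(J / n) / (2 * √K))) ≤
      2 * K * c₂ * riskRate β n α ε := by
  have hJ0 : (0 : ℝ) < J := by exact_mod_cast hJ₁
  have hK0 : 0 < √K := Real.sqrt_pos.2 (by linarith)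
  set u := √((J : ℝ) / n) with hu
  have hu0 : 0 < u := Real.sqrt_pos.2 (by positivity)
  have hu2 : u * u = J / n := Real.mul_self_sqrt (by positivity)
  have h1 : u / α ≤ √K * √(Real.log (n * α ^ 2) / (n * α ^ 2)) := by
    rw [← Real.sqrt_mul (by linarith)]
    refine Real.le_sqrt_of_sq_le ?_
    rw [div_pow, sq u, hu2, div_div, mul_div_assoc']
    gcongr
  calc √(2 ^ J) * √(2 ^ J) / α / n * (J / (u / (2 * √K)))
      = 2 * √K * (√(2 ^ J) * √(2 ^ J)) * (J / n) / u / α := by field_simp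
    _ = 2 * √K * 2 ^ J * (u / α) := by
        rw [← hu2, Real.mul_self_sqrt (by positivity)]
        field_simp
    _ ≤ 2 * √K * 2 ^ J * (√K * √(Real.log (n * α ^ 2) / (n * α ^ 2))) := by gcongr
    _ = 2 * (√K * √K) * (2 ^ J * √(Real.log (n * α ^ 2) / (n * α ^ 2))) := by ring
    _ ≤ 2 * (√K * √K) * (c₂ * riskRate β n α ε) :=
        mul_le_mul_of_nonneg_left (two_pow_mul_sqrt_le hβ hN hc₂ hJ) (by positivity)
    _ = _ := by rw [Real.mul_self_sqrt (by linarith)]; ring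

lemma lintegral_affine_le {Ω : Type*} [MeasurableSpace Ω] {P : Measure Ω} [IsProbabilityMeasure P]
    {R : Ω → ℝ} {c b m : ℝ} (hR : ∀ ω, 0 ≤ R ω) (hc : 0 ≤ c) (hb : 0 ≤ b) (hm : 0 ≤ m)
    (h : ∫⁻ ω, ENNReal.ofReal (R ω) ∂P ≤ ENNReal.ofReal m) :
    ∫⁻ ω, ENNReal.ofReal (c * R ω + b) ∂P ≤ ENNReal.ofReal (c * m + b) := by
  have hsplit : ∀ ω, ENNReal.ofReal (c * R ω + b) =
      ENNReal.ofReal c * ENNReal.ofReal (R ω) + ENNReal.ofReal b := fun ω => by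
    rw [← ENNReal.ofReal_mul hc, ← ENNReal.ofReal_add (mul_nonneg hc (hR ω)) hb]
  simp_rw [hsplit]
  rw [lintegral_add_right _ measurable_const, lintegral_const_mul' _ _ ENNReal.ofReal_ne_top,
    lintegral_const, measure_univ, mul_one, ENNReal.ofReal_add (mul_nonneg hc hm) hb,
    ENNReal.ofReal_mul hc]
  gcongr

/-- The exponent `t = √(J / n) / (2 √K)` balances `J / t` against `n t`. -/
lemma exponent_choice {K : ℝ} {n J : ℕ} (hn : 0 < (n : ℝ)) (hK : 1 ≤ K) (hJ : 1 ≤ (J : ℝ))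
    (hJn : (J : ℝ) ≤ K * n) :
    0 < √(J / n) / (2 * √K) ∧ √(J / n) / (2 * √K) ≤ 1 / 2 ∧
      4 * n * (√(J / n) / (2 * √K)) ^ 2 ≤ J := by
  have hK0 : 0 < √K := Real.sqrt_pos.2 (by linarith)
  have hu : 0 < √((J : ℝ) / n) := Real.sqrt_pos.2 (by positivity)
  refine ⟨by positivity, ?_, ?_⟩
  · have : √((J : ℝ) / n) ≤ √K := Real.sqrt_le_sqrt ((div_le_iff₀ hn).2 hJn)
    rw [div_le_iff₀ (by positivity)]
    linarith
  · have : 4 * n * (√(J / n) / (2 * √K)) ^ 2 = J / K := by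
      rw [div_pow, mul_pow, Real.sq_sqrt (by positivity), Real.sq_sqrt (by linarith)]
      field_simp
      norm_num
    rw [this]
    exact div_le_self (by linarith) hK

lemma two_mul_card_mul_exp_le {A v : ℝ} (hA : 0 < A) {N : ℕ → Finset ℤ}
    (hN : ∀ l, ∀ k ∈ N l, -A ≤ (k : ℝ) ∧ (k : ℝ) ≤ scale l + A) {J : ℕ} (hJ : 1 ≤ (J : ℝ))
    (hv : v ≤ J) :
    2 * (((Finset.range (J + 2)).sigma N).card : ℝ) * Real.exp v ≤
      Real.exp ((Real.log (8 * A + 8) + 2) * J) := by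
  have h1 := card_sigma_le hA hN J
  have h2 : (2 : ℝ) ^ J ≤ Real.exp J := by
    rw [← Real.exp_one_pow]
    exact pow_le_pow_left₀ (by norm_num) (by linarith [Real.add_one_le_exp 1]) J
  have hL0 : 0 < Real.log (8 * A + 8) := Real.log_pos (by linarith)
  calc 2 * (((Finset.range (J + 2)).sigma N).card : ℝ) * Real.exp v
      ≤ (8 * A + 8) * Real.exp J * Real.exp J := by
        refine mul_le_mul ?_ (Real.exp_le_exp.2 hv) (Real.exp_pos _).le (by positivity)
        nlinarith
    _ = Real.exp (Real.log (8 * A + 8) + J + J) := by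
        rw [Real.exp_add, Real.exp_add, Real.exp_log (by linarith)]
    _ ≤ _ := Real.exp_le_exp.2 (by nlinarith)

/-- Each of the three parts of the risk is of the order of the rate. -/
lemma total_order_le {β c₁ c₂ α ε K D M L r : ℝ} {n J : ℕ} (hn : 0 < (n : ℝ)) (hα : 0 < α)
    (hβ : 1 / 2 < β) (hN : 2 ≤ (n : ℝ) * α ^ 2) (hc₁ : 0 < c₁) (hc₂ : 0 < c₂) (hε : 0 ≤ ε)
    (hK : 1 ≤ K) (hD : 0 ≤ D) (hM : 0 ≤ M) (hL : 0 ≤ L) (hr : 0 ≤ r) (hJ₁ : 1 ≤ J)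
    (hJlo : c₁ * resolutionRate β n α ε ≤ (2 : ℝ) ^ J)
    (hJhi : (2 : ℝ) ^ J ≤ c₂ * resolutionRate β n α ε)
    (hJK : (J : ℝ) ≤ K * Real.log (n * α ^ 2)) :
    6 * D * √(2 ^ J) * (M * √(2 ^ J) / α / n) *
        (((L + 2) * J + 1) / (√(J / n) / (2 * √K))) +
      (4 * D * M * (ε * 2 ^ J) +
        D * r * ((2 : ℝ) ^ (1 / 2 - β)) ^ J * (1 - (2 : ℝ) ^ (1 / 2 - β))⁻¹) ≤
    (6 * D * M * (L + 3) * (2 * K * c₂) + (4 * D * M * c₂ +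
      D * r * c₁ ^ (1 / 2 - β) * (1 - (2 : ℝ) ^ (1 / 2 - β))⁻¹)) * riskRate β n α ε := by
  have hJ0 : (1 : ℝ) ≤ J := by exact_mod_cast hJ₁
  have h1 : 6 * D * √(2 ^ J) * (M * √(2 ^ J) / α / n) *
      (((L + 2) * J + 1) / (√(J / n) / (2 * √K))) ≤
      6 * D * M * (L + 3) * (2 * K * c₂ * riskRate β n α ε) := by
    have h0 : ((L + 2) * J + 1) / (√(J / n) / (2 * √K)) ≤
        (L + 3) * (J / (√(J / n) / (2 * √K))) := by
      rw [← mul_div_assoc]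
      exact div_le_div_of_nonneg_right (by linarith) (by positivity)
    refine (mul_le_mul_of_nonneg_left h0 (by positivity)).trans ?_
    refine le_trans (le_of_eq ?_) (mul_le_mul_of_nonneg_left
      (stochastic_order_le hn hα hβ hN hc₂ hK hJ₁ hJhi hJK)
      (show 0 ≤ 6 * D * M * (L + 3) by positivity))
    ring
  have h2 : 4 * D * M * (ε * 2 ^ J) ≤ 4 * D * M * (c₂ * riskRate β n α ε) :=
    mul_le_mul_of_nonneg_left (mul_two_pow_le hβ hc₂ hε hJhi) (by positivity)
  have h3 : D * r * ((2 : ℝ) ^ (1 / 2 - β)) ^ J * (1 - (2 : ℝ) ^ (1 / 2 - β))⁻¹ ≤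
      D * r * (c₁ ^ (1 / 2 - β) * riskRate β n α ε) * (1 - (2 : ℝ) ^ (1 / 2 - β))⁻¹ :=
    mul_le_mul_of_nonneg_right (mul_le_mul_of_nonneg_left
      (two_rpow_half_sub_pow_le hβ hN hc₁ hε hJlo) (by positivity))
      (inv_nonneg.2 (by linarith [two_rpow_half_sub_lt_one hβ]))
  linarith

end PrivateDensity

theorem theorem8 (A : ℝ) (hA : 0 < A) (φ ψ : ℝ → ℝ)
    (hφψ : PrivateDensity.IsWaveletPair A φ ψ) (β : ℝ) (hβ : 1 / 2 < β)
    (r : ℝ) (hr : 0 < r) (c₁ c₂ : ℝ) (hc₁ : 0 < c₁) (hc₂ : 0 < c₂) :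
    ∃ C : ℝ, 0 < C ∧
      ∀ (n : ℕ) (α ε : ℝ), α ∈ Set.Ioo (0 : ℝ) 1 → ε ∈ Set.Icc (0 : ℝ) 1 →
        2 ≤ (n : ℝ) * α ^ 2 →
      ∀ J : ℕ, 1 ≤ J →
        c₁ * PrivateDensity.resolutionRate β n α ε ≤ (2 : ℝ) ^ J →
        (2 : ℝ) ^ J ≤ c₂ * PrivateDensity.resolutionRate β n α ε →
      ∀ f ∈ PrivateDensity.SobolevClass φ ψ β,
        PrivateDensity.sobolevNormSq φ ψ β f ≤ r ^ 2 →
      ∀ G : MeasureTheory.Measure ℝ, MeasureTheory.IsProbabilityMeasure G →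
        G (Set.Icc (0 : ℝ) 1)ᶜ = 0 →
      ∀ N : ℕ → Finset ℤ, PrivateDensity.IsIndexFamily A φ ψ f N →
      ∀ (Ω : Type*) (_ : MeasurableSpace Ω) (P : MeasureTheory.Measure Ω)
        (X : Fin n → Ω → ℝ) (W : Fin n → ℕ → ℤ → Ω → ℝ),
        MeasureTheory.IsProbabilityMeasure P →
        (∀ i, ProbabilityTheory.HasLaw (X i) (PrivateDensity.contaminated ε f G) P) →
        (∀ i l k, ProbabilityTheory.HasLaw (W i l k) PrivateDensity.stdLaplace P) →
        ProbabilityTheory.iIndepFun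
          (Sum.elim X (fun p : Fin n × ℕ × ℤ => W p.1 p.2.1 p.2.2)) P →
        -- the loss as an essential supremum over `[0, 1]`
        (∫⁻ ω, MeasureTheory.eLpNormEssSup
            (fun x => PrivateDensity.fLap A φ ψ α J N (fun i => X i ω)
              (fun i l k => W i l k ω) x - f x)
            (MeasureTheory.volume.restrict (Set.Icc (0 : ℝ) 1)) ∂P
          ≤ ENNReal.ofReal (C * PrivateDensity.riskRate β n α ε)) ∧
        -- the loss as a supremum, for the version of `f` given by its wavelet series
        ((∀ x ∈ Set.Icc (0 : ℝ) 1, HasSum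
            (fun p : ℕ × ℤ => PrivateDensity.coeff φ ψ f p.1 p.2 *
              PrivateDensity.wavelet φ ψ p.1 p.2 x) (f x)) →
          ∫⁻ ω, ⨆ x ∈ Set.Icc (0 : ℝ) 1, ENNReal.ofReal
            |PrivateDensity.fLap A φ ψ α J N (fun i => X i ω)
              (fun i l k => W i l k ω) x - f x| ∂P
          ≤ ENNReal.ofReal (C * PrivateDensity.riskRate β n α ε)) := by
  open PrivateDensity in
  obtain ⟨Mφ, hMφ⟩ := hφψ.father_bounded
  obtain ⟨Mψ, hMψ⟩ := hφψ.mother_bounded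
  set CA := (8 * (⌈A⌉ : ℝ) + 4) * (⨆ x, |ψ x|) * √2 * (√2 - 1)⁻¹ with hCA
  -- `M` also dominates the constant of the noise level, so that `M 2^{J/2} / α` dominates both the
  -- wavelets up to level `J` and the noise level
  set M := max (max Mφ Mψ) (max |CA| 1) with hMdef
  have hM1 : 1 ≤ M := (le_max_right _ _).trans (le_max_right _ _)
  have hM0 : 0 < M := by linarith
  have hφ : ∀ x, |φ x| ≤ M := fun x =>
    (hMφ ⟨x, rfl⟩).trans ((le_max_left _ _).trans (le_max_left _ _))
  have hψ : ∀ x, |ψ x| ≤ M := fun x =>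
    (hMψ ⟨x, rfl⟩).trans ((le_max_right _ _).trans (le_max_left _ _))
  obtain ⟨K, hK1, hK⟩ := exists_level_le_mul_log (β := β) hβ hc₂
  set D := (2 * A + 1) * M with hD
  have hD0 : 0 < D := by positivity
  set L := Real.log (8 * A + 8) with hL
  have hL0 : 0 < L := Real.log_pos (by linarith)
  have hρ : 0 < (1 - (2 : ℝ) ^ (1 / 2 - β))⁻¹ :=
    inv_pos.2 (by linarith [two_rpow_half_sub_lt_one hβ])
  refine ⟨6 * D * M * (L + 3) * (2 * K * c₂) + (4 * D * M * c₂ +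
    D * r * c₁ ^ (1 / 2 - β) * (1 - (2 : ℝ) ^ (1 / 2 - β))⁻¹), by positivity, ?_⟩
  intro n α ε hα hε hN2 J hJ1 hJlo hJhi f hf hnorm G hG _ N hN Ω _ P X W hP hX hW hind
  obtain ⟨hf0, -, hf2, hf1, hfs⟩ := hf
  have hα0 := hα.1
  have hn0 : (0 : ℝ) < n := by
    by_contra h
    nlinarith [sq_nonneg α]
  have hn : 0 < n := by exact_mod_cast hn0
  have hJ0 : (1 : ℝ) ≤ J := by exact_mod_cast hJ1
  have hJK := hK n α ε J hN2 hJhi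
  have hJn : (J : ℝ) ≤ K * n := by
    refine hJK.trans (mul_le_mul_of_nonneg_left ?_ (by linarith))
    have h1 := Real.log_le_sub_one_of_pos (show 0 < (n : ℝ) * α ^ 2 by linarith)
    have h2 : (n : ℝ) * α ^ 2 ≤ n := mul_le_of_le_one_right hn0.le (pow_le_one₀ hα0.le hα.2.le)
    linarith
  obtain ⟨ht0, ht2, hnt⟩ := exponent_choice hn0 hK1 hJ0 hJn
  have hcard := two_mul_card_mul_exp_le hA (fun l k hk => (hN l k).2 hk) hJ0 hnt
  rw [← hL] at hcard
  have hnoise : |noiseLevel A ψ α J| ≤ M * √(2 ^ J) / α := by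
    have h2 : (2 : ℝ) ^ ((J : ℝ) / 2) = √(2 ^ J) := (sqrt_scale_succ J).symm
    rw [noiseLevel, ← hCA, h2, abs_div, abs_mul, abs_of_pos hα0, abs_of_nonneg (Real.sqrt_nonneg _)]
    gcongr
    exact (le_max_left _ _).trans (le_max_right _ _)
  obtain ⟨R, hR0, hR, hRint⟩ := exists_stochastic_bound hn hφψ.measurable_father
    hφψ.measurable_mother hφ hψ hM0 hα hnoise hX hW hind ht0 ht2 (by positivity) hcard
  set q := M * √(2 ^ J) / α / n with hq
  have hq0 : 0 < q := by positivity
  set b := 4 * D * M * (ε * 2 ^ J) +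
    D * r * ((2 : ℝ) ^ (1 / 2 - β)) ^ J * (1 - (2 : ℝ) ^ (1 / 2 - β))⁻¹ with hb
  have hb0 : 0 ≤ b := by
    have := hε.1
    positivity
  set B : Ω → ℝ := fun ω => 6 * D * √(2 ^ J) * q * R ω + b with hB
  have hloss : ∀ ω x, HasSum (fun p : ℕ × ℤ => coeff φ ψ f p.1 p.2 * wavelet φ ψ p.1 p.2 x)
      (f x) → |fLap A φ ψ α J N (fun i => X i ω) (fun i l k => W i l k ω) x - f x| ≤ B ω :=
    fun ω x hx => by
      refine (abs_fLap_sub_le hA hφψ.measurable_father hφψ.measurable_mother hφψ.father_eq_zero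
        hφψ.mother_eq_zero hφ hψ hβ hr.le hε hf0 hf1 hfs hnorm (fun l k => (hN l k).1)
        (mul_nonneg hq0.le (hR0 ω)) (fun l hl k hk => hR l hl k hk ω) hx).trans_eq ?_
      simp only [hB, hb]
      ring
  have hBint : ∫⁻ ω, ENNReal.ofReal (B ω) ∂P ≤ ENNReal.ofReal
      ((6 * D * M * (L + 3) * (2 * K * c₂) + (4 * D * M * c₂ +
        D * r * c₁ ^ (1 / 2 - β) * (1 - (2 : ℝ) ^ (1 / 2 - β))⁻¹)) * riskRate β n α ε) := by
    have hm : 0 ≤ ((L + 2) * J + 1) / (√(J / n) / (2 * √K)) := by positivity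
    exact (lintegral_affine_le hR0 (by positivity) hb0 hm hRint).trans
      (ENNReal.ofReal_le_ofReal (total_order_le hn0 hα0 hβ hN2 hc₁ hc₂ hε.1 hK1 hD0.le hM0.le
        hL0.le hr.le hJ1 hJlo hJhi hJK))
  refine ⟨(lintegral_mono fun ω => ?_).trans hBint, fun hx =>
    (lintegral_mono fun ω => ?_).trans hBint⟩
  · refine eLpNormEssSup_le_of_ae_bound ?_
    filter_upwards [ae_restrict_of_ae
      (ae_hasSum_series hA hφψ hφ hψ hβ hr.le hf2 hfs hnorm)] with x hx
    exact hloss ω x hx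
  · exact iSup₂_le fun x hx' => ENNReal.ofReal_le_ofReal (hloss ω x (hx x hx'))
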